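/- Let $\mathbb D$ be the open unit disk of $\mathbb C$, $\mathbb D^*=\mathbb D\setminus\{0\}$, let $dA$ be the area measure divided by $\pi$, and let $\mathscr B$ be the beta function. For $\alpha,\beta>-1$ put $$d\mu_{\alpha,\beta}(z)=\frac{1}{\mathscr B(\alpha+1,\beta+1)}|z|^{2\beta}(1-|z|^2)^{\alpha}\,dA(z)\quad\text{on }\mathbb D,$$ and let $\mathcal A^p_{\alpha,\beta}$ be the space of holomorphic functions $f$ on $\mathbb D^*$ with $\|f\|_{\alpha,\beta,p}=\big(\int_{\mathbb D}|f|^p\,d\mu_{\alpha,\beta}\big)^{1/p}<\infty$, with this norm. Write $\beta=\beta_0+m$ with $m\in\mathbb N=\{0,1,2,\dots\}$ and $-1<\beta_0\le 0$, and for $\xi\in\mathbb D$ let $$Q_{\alpha,\beta}(\xi)=\begin{cases}(\alpha+1)\,\mathscr B(\alpha+1,\beta+1)&\text{if }\beta\in\mathbb N,\\[1mm] \dfrac{\mathscr B(\alpha+1,\beta+1)}{\mathscr B(\alpha+1,\beta_0+1)}\displaystyle\sum_{n=0}^{\infty}\frac{\beta_0}{n+\beta_0}\binom{\alpha+1}{n}(-\xi)^n&\text{if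 }\beta\notin\mathbb N.\end{cases}$$ Let $\mathcal J_\alpha$ be the set of those $\beta\in(-1,0]$ for which $Q_{\alpha,\beta}$ has no zero in $\mathbb D$. The Bergman projection is $$\mathbb P_{\alpha,\beta}f(z)=\int_{\mathbb D}f(w)\,\frac{Q_{\alpha,\beta}(z\overline w)}{(z\overline w)^m(1-z\overline w)^{2+\alpha}}\,d\mu_{\alpha,\beta}(w),\qquad z\in\mathbb D^*,$$ with the principal branch of the power, and the Toeplitz operator with symbol $\varphi\in L^\infty(\mathbb D)$ is $T_\varphi f=\mathbb P_{\alpha,\beta}(\varphi f)$. **Lemma.** Let $\alpha,\beta>-1$ and $\beta=\beta_0+m$ with $m\in\mathbb N$ and $\beta_0\in\mathcal J_\alpha$. Let $p$ be a real number with $$\frac{2(\beta+1)}{2(\beta+1)-m}<p<\frac{2(\beta+1)}{m}$$ (for $m=0$ this means $1<p<\infty$). Let $\varphi\in L^\infty(\mathbb D)$ have compact support in $\mathbb D$, i.e. $\varphi=0$ almost everywhere on $\mathbb D\setminus K$ for some compact $K\subset\mathbb D$. Then for every $f\in\mathcal A^p_{\alpha,\beta}$ the integral defining $T_\varphi f(z)$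 converges absolutely at every $z\in\mathbb D^*$, $T_\varphi f$ is holomorphic on $\mathbb D^*$ and belongs to $\mathcal A^p_{\alpha,\beta}$, and $T_\varphi$ is a compact linear operator on $\mathcal A^p_{\alpha,\beta}$. -/

import Mathlib

open MeasureTheory
open scoped ENNReal ComplexConjugate

noncomputable section

namespace ModifiedBergman

/-- The open unit disk of the complex plane. -/
def disk : Set ℂ := Metric.ball 0 1

/-- The punctured unit disk. -/
def puncturedDisk : Set ℂ := disk \ {0}

/-- The measure `|z|^(2β) (1 - |z|²)^α dA(z) / B(α+1, β+1)` on the unit disk, where `dA` is the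
area measure divided by `π` and `B` is the beta function. It is regarded as a measure on `ℂ` carried by the disk. -/
def modMeasure (α β : ℝ) : Measure ℂ :=
  (volume.restrict disk).withDensity fun z =>
    ENNReal.ofReal (‖z‖ ^ (2 * β) * (1 - ‖z‖ ^ 2) ^ α /
      (Real.pi * ProbabilityTheory.beta (α + 1) (β + 1)))

/-- The function `Q_{α,β}` for `β = β₀ + m` with `m` a natural number and `-1 < β₀ ≤ 0`; the case
`β₀ = 0` is the one in which `β` is a natural number. -/
def Q (α β₀ : ℝ) (m : ℕ) (ξ : ℂ) : ℂ :=
  if β₀ = 0 then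
    (((α + 1) * ProbabilityTheory.beta (α + 1) (β₀ + m + 1) : ℝ) : ℂ)
  else
    ((ProbabilityTheory.beta (α + 1) (β₀ + m + 1) /
        ProbabilityTheory.beta (α + 1) (β₀ + 1) : ℝ) : ℂ) *
      ∑' n : ℕ, ((β₀ / (n + β₀) * Ring.choose (α + 1) n : ℝ) : ℂ) * (-ξ) ^ n

/-- The set `J_α` of those `β` in `(-1, 0]` for which `Q_{α,β}` has no zero in the unit disk. -/
def J (α : ℝ) : Set ℝ :=
  {β | -1 < β ∧ β ≤ 0 ∧ ∀ ξ ∈ disk, Q α β 0 ξ ≠ 0}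

/-- The function `ξ ↦ Q_{α,β}(ξ) / (ξ^m (1 - ξ)^(2 + α))`, with the principal branch of the
power; the Bergman kernel is `(w, z) ↦ kernelFn (w * conj z)`. -/
def kernelFn (α β₀ : ℝ) (m : ℕ) (ξ : ℂ) : ℂ :=
  Q α β₀ m ξ / (ξ ^ m * (1 - ξ) ^ ((2 + α : ℝ) : ℂ))

/-- The Bergman projection `P_{α,β}`, `β = β₀ + m`, given by its integral formula. -/
def bergmanProj (α β₀ : ℝ) (m : ℕ) (f : ℂ → ℂ) (z : ℂ) : ℂ :=
  ∫ w, f w * kernelFn α β₀ m (z * conj w) ∂modMeasure α (β₀ + m)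

/-- The Toeplitz operator with symbol `φ`, on functions: `T_φ f = P_{α,β} (φ f)`. -/
def toeplitz (α β₀ : ℝ) (m : ℕ) (φ f : ℂ → ℂ) : ℂ → ℂ :=
  bergmanProj α β₀ m fun w => φ w * f w

/-- The `β`-modified Bergman space `A^p_{α,β}`: the holomorphic functions on the punctured disk
that lie in `L^p(μ_{α,β})`, as a subspace of `L^p(μ_{α,β})`, with the norm and the topology
of the latter. -/
def bergmanSpace (α β p : ℝ) : Submodule ℂ (Lp ℂ (ENNReal.ofReal p) (modMeasure α β)) where
  carrier := {f | ∃ g : ℂ → ℂ, DifferentiableOn ℂ g puncturedDisk ∧ f =ᵐ[modMeasure α β] g}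
  zero_mem' := ⟨0, differentiableOn_const 0, Lp.coeFn_zero _ _ _⟩
  add_mem' := by
    rintro f₁ f₂ ⟨g₁, hg₁, h₁⟩ ⟨g₂, hg₂, h₂⟩
    exact ⟨g₁ + g₂, hg₁.add hg₂, (Lp.coeFn_add f₁ f₂).trans (h₁.add h₂)⟩
  smul_mem' := by
    rintro c f ⟨g, hg, h⟩
    exact ⟨c • g, hg.const_smul c, (Lp.coeFn_smul c f).trans (h.const_smul c)⟩

end ModifiedBergman

end

open MeasureTheory
open scoped ENNReal ComplexConjugate

namespace ModifiedBergman

/-! The operator factors through `ℓ¹`, compactly. Since `Q(ξ) / (1 - ξ)^(2+α)` is holomorphic on the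
disk, with Taylor coefficients `c n`, the kernel is `∑ c n ξ^(n-m)`, and `z^m T_φ f(z) = ∑ c n
ℓ_n(f) z^n` with `ℓ_n(f) = ∫ φ (conj w)^(n-m) f dμ`. As `φ` lives in `|w| ≤ r < 1`, Hölder bounds
`‖ℓ_n‖` by a multiple of `r^n`, and `∑ |c n| r^n < ∞`. So `f ↦ (c n ℓ_n(f))` is a norm-convergent
series of rank-one maps into `ℓ¹`, hence compact (`exists_analysis_operator`). The map `a ↦ z^(-m) ∑
a n z^n` is bounded from `ℓ¹` to the Bergman space (`exists_synthesis_operator`), and `T_φ` is the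
composite (`integrable_and_hasSum_toeplitz`). The two bounds on `p` say that `|z|^(-m)` lies in
`L^p` and in `L^q`, `q` the conjugate exponent. -/

/-! ### Integrability of powers of `|z|`. -/

theorem integrableOn_rpow_mul_one_sub_rpow {a b : ℝ} (ha : -1 < a) (hb : -1 < b) :
    IntegrableOn (fun x : ℝ => x ^ a * (1 - x) ^ b) (Set.Ioo 0 1) := by
  have h := Complex.betaIntegral_convergent (u := ((a + 1 : ℝ) : ℂ)) (v := ((b + 1 : ℝ) : ℂ))
    (by simpa using by linarith) (by simpa using by linarith)
  rw [intervalIntegrable_iff_integrableOn_Ioo_of_le zero_le_one] at h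
  refine (integrableOn_congr_fun (fun x hx => ?_) measurableSet_Ioo).mp h.norm
  have h1 : (1 : ℂ) - (x : ℂ) = ((1 - x : ℝ) : ℂ) := by push_cast; ring
  rw [norm_mul, h1, Complex.norm_cpow_eq_rpow_re_of_pos hx.1,
    Complex.norm_cpow_eq_rpow_re_of_pos (sub_pos.2 hx.2)]
  simp

/-- Polar coordinates contribute a factor `y`, which reduces the claim to a beta integral with
exponents `c + 1` and `α`. -/
theorem integrableOn_disk_norm_rpow {c α : ℝ} (hc : -2 < c) (hα : -1 < α) :
    IntegrableOn (fun z : ℂ => ‖z‖ ^ c * (1 - ‖z‖ ^ 2) ^ α) disk := by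
  have hd : (fun z : ℂ => (Set.Iio (1 : ℝ)).indicator (fun y => y ^ c * (1 - y ^ 2) ^ α) ‖z‖) =
      disk.indicator fun z : ℂ => ‖z‖ ^ c * (1 - ‖z‖ ^ 2) ^ α := by
    ext z
    by_cases hz : ‖z‖ < 1
    · rw [Set.indicator_of_mem (by simpa using hz),
        Set.indicator_of_mem (by simpa [disk] using hz)]
    · rw [Set.indicator_of_notMem (by simpa using hz),
        Set.indicator_of_notMem (by simpa [disk] using hz)]
  rw [← integrable_indicator_iff (show MeasurableSet disk from measurableSet_ball), ← hd,
    integrable_fun_norm_addHaar volume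
      (f := (Set.Iio (1 : ℝ)).indicator fun y => y ^ c * (1 - y ^ 2) ^ α)]
  have h2 : (fun y : ℝ => y ^ (Module.finrank ℝ ℂ - 1) •
      (Set.Iio (1 : ℝ)).indicator (fun y => y ^ c * (1 - y ^ 2) ^ α) y) =
      (Set.Iio (1 : ℝ)).indicator fun y => y * (y ^ c * (1 - y ^ 2) ^ α) := by
    ext y
    by_cases hy : y < 1 <;> simp [hy, Complex.finrank_real_complex]
  rw [h2, IntegrableOn, integrable_indicator_iff measurableSet_Iio, IntegrableOn,
    Measure.restrict_restrict measurableSet_Iio, Set.inter_comm, Set.Ioi_inter_Iio]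
  refine Integrable.mono' ((integrableOn_rpow_mul_one_sub_rpow (a := c + 1) (b := α)
    (by linarith) hα).const_mul (2 ^ |α|)) (by fun_prop) ?_
  refine (ae_restrict_mem measurableSet_Ioo).mono fun y hy => ?_
  have hy0 := hy.1
  have h1y : 0 < 1 - y := sub_pos.2 hy.2
  have h3 : (1 - y ^ 2) ^ α = (1 - y) ^ α * (1 + y) ^ α := by
    rw [← Real.mul_rpow h1y.le (by linarith)]
    ring_nf
  -- The absolute value covers both signs of `α`, since `1 ≤ 1 + y ≤ 2`.
  have h4 : (1 + y) ^ α ≤ 2 ^ |α| :=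
    (Real.rpow_le_rpow_of_exponent_le (by linarith) (le_abs_self α)).trans
      (Real.rpow_le_rpow (by linarith) (by linarith [hy.2]) (abs_nonneg α))
  have h5 : 0 < 1 - y ^ 2 := by nlinarith [hy.2]
  rw [Real.norm_of_nonneg (by positivity), h3, Real.rpow_add_one hy0.ne']
  calc y * (y ^ c * ((1 - y) ^ α * (1 + y) ^ α))
      = (y ^ c * y * (1 - y) ^ α) * (1 + y) ^ α := by ring
    _ ≤ (y ^ c * y * (1 - y) ^ α) * 2 ^ |α| := by gcongr
    _ = _ := by ring

theorem memLp_norm_pow_inv {α β s : ℝ} {m : ℕ} (hα : -1 < α) (hs : 0 < s)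
    (hsm : s * m < 2 * (β + 1)) :
    MemLp (fun z : ℂ => (‖z‖ ^ m)⁻¹) (ENNReal.ofReal s) (modMeasure α β) := by
  rw [← integrable_norm_rpow_iff (Measurable.aestronglyMeasurable (by fun_prop))
    (by simpa using hs) ENNReal.ofReal_ne_top, ENNReal.toReal_ofReal hs.le, modMeasure,
    integrable_withDensity_iff (by fun_prop) (by simp)]
  have h := (integrableOn_disk_norm_rpow (c := 2 * β - s * m) (α := α) (by linarith) hα).mul_const
    (Real.pi * ProbabilityTheory.beta (α + 1) (β + 1))⁻¹
  -- Splitting the exponent `2β - sm` needs `‖z‖ > 0`.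
  have h0 : ∀ᵐ z : ℂ ∂volume.restrict disk, z ≠ 0 := by
    refine ae_restrict_of_ae ?_
    simp [ae_iff]
  have hβ : 0 < β + 1 := by
    have : 0 ≤ s * m := by positivity
    linarith
  have hB := ProbabilityTheory.beta_pos (show 0 < α + 1 by linarith) hβ
  refine h.congr ?_
  filter_upwards [h0, ae_restrict_mem (show MeasurableSet disk from measurableSet_ball)]
    with z hz hzd
  have hz1 : ‖z‖ < 1 := by simpa [disk] using hzd
  have hz0 : 0 < ‖z‖ := norm_pos_iff.2 hz
  have h1 : 0 < 1 - ‖z‖ ^ 2 := by nlinarith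
  have hpi := Real.pi_pos
  rw [ENNReal.toReal_ofReal (by positivity), Real.norm_of_nonneg (by positivity),
    Real.rpow_sub hz0, Real.inv_rpow (by positivity), ← Real.rpow_natCast_mul hz0.le,
    mul_comm (m : ℝ) s]
  field_simp

/-! ### Power series of the kernel. -/

theorem exists_hasSum_pow_of_differentiableOn {g : ℂ → ℂ} (hg : DifferentiableOn ℂ g disk) :
    ∃ c : ℕ → ℂ, (∀ ξ ∈ disk, HasSum (fun n => c n * ξ ^ n) (g ξ)) ∧
      ∀ r : ℝ, 0 ≤ r → r < 1 → Summable fun n => ‖c n‖ * r ^ n := by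
  have h : ∀ ξ ∈ disk, HasSum (fun n => (iteratedDeriv n g 0 / n.factorial) * ξ ^ n) (g ξ) := by
    intro ξ hξ
    have := Complex.hasSum_taylorSeries_on_ball (c := 0) (r := 1) (f := g) hg hξ
    refine this.congr_fun fun n => ?_
    simp; ring
  refine ⟨_, h, fun r hr hr1 => ?_⟩
  have := (h (r : ℂ) (by simpa [disk, abs_of_nonneg hr] using hr1)).summable.norm
  simpa [abs_of_nonneg hr] using this

theorem differentiableOn_Q {α β₀ : ℝ} {m : ℕ} (hβ₀ : -1 < β₀) :
    DifferentiableOn ℂ (Q α β₀ m) disk := by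
  by_cases h0 : β₀ = 0
  · unfold Q
    simp only [h0, if_true]
    exact differentiableOn_const _
  unfold Q
  simp only [h0, if_false]
  refine DifferentiableOn.const_mul ?_ _
  have key : ∀ r : ℝ, 0 ≤ r → r < 1 → Summable fun n : ℕ =>
      ‖((β₀ / (n + β₀) * Ring.choose (α + 1) n : ℝ) : ℂ)‖ * r ^ n := by
    intro r hr hr1
    have hs := (binomialSeries ℝ (α + 1)).summable_norm_mul_pow (r := ⟨r, hr⟩)
      (lt_of_lt_of_le (ENNReal.coe_lt_one_iff.2 (by exact hr1)) binomialSeries_radius_ge_one)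
    simp only [binomialSeries, FormalMultilinearSeries.ofScalars_norm] at hs
    have hs' : Summable fun n : ℕ => |Ring.choose (α + 1) n| * r ^ n := hs
    refine Summable.of_nonneg_of_le (fun n => by positivity) (fun n => ?_)
      (hs'.mul_left (1 + |β₀| / (1 + β₀)))
    -- The quotient is `1` at `n = 0`, and `n + β₀ ≥ 1 + β₀ > 0` afterwards, so the series is
    -- dominated by the binomial one.
    have hb : |β₀ / (n + β₀)| ≤ 1 + |β₀| / (1 + β₀) := by
      have h1 : 0 < 1 + β₀ := by linarith
      rcases Nat.eq_zero_or_pos n with rfl | hn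
      · simp [h0]
        positivity
      · have hn' : (1 : ℝ) ≤ n := by exact_mod_cast hn
        rw [abs_div, abs_of_pos (show (0 : ℝ) < n + β₀ by linarith)]
        have : |β₀| / (n + β₀) ≤ |β₀| / (1 + β₀) := by gcongr
        linarith
    rw [Complex.norm_real, Real.norm_eq_abs, abs_mul, mul_assoc]
    gcongr
  intro ξ hξ
  have hξ1 : ‖ξ‖ < 1 := by simpa [disk] using hξ
  obtain ⟨r, hr, hr1⟩ := exists_between hξ1
  have hr0 : 0 ≤ r := (norm_nonneg ξ).trans hr.le
  have hd : DifferentiableOn ℂ (fun ξ : ℂ => ∑' n : ℕ,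
      ((β₀ / (n + β₀) * Ring.choose (α + 1) n : ℝ) : ℂ) * (-ξ) ^ n) (Metric.ball 0 r) := by
    refine Complex.differentiableOn_tsum_of_summable_norm (key r hr0 hr1) (fun n => by fun_prop)
      Metric.isOpen_ball fun n w hw => ?_
    rw [norm_mul, norm_pow, norm_neg]
    have : ‖w‖ ≤ r := by simpa using (Metric.mem_ball.1 hw).le
    gcongr
  exact (hd.differentiableAt (Metric.isOpen_ball.mem_nhds (by simpa using hr))).differentiableWithinAt

/-- At `ξ = 0` with `m > 0` both sides are `0`, as division by zero gives zero, so the origin needs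
no exclusion. -/
theorem exists_hasSum_kernelFn {α β₀ : ℝ} {m : ℕ} (hβ₀ : -1 < β₀) :
    ∃ c : ℕ → ℂ, (∀ ξ ∈ disk, HasSum (fun n => c n * ξ ^ n / ξ ^ m) (kernelFn α β₀ m ξ)) ∧
      ∀ r : ℝ, 0 ≤ r → r < 1 → Summable fun n => ‖c n‖ * r ^ n := by
  have hslit : ∀ ξ ∈ disk, (1 : ℂ) - ξ ∈ Complex.slitPlane := fun ξ hξ => by
    have hξ1 : ‖ξ‖ < 1 := by simpa [disk] using hξ
    left
    simpa using (Complex.re_le_norm ξ).trans_lt hξ1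
  have hd : DifferentiableOn ℂ (fun ξ => Q α β₀ m ξ / (1 - ξ) ^ ((2 + α : ℝ) : ℂ)) disk := by
    refine (differentiableOn_Q hβ₀).div ?_ fun ξ hξ => ?_
    · exact DifferentiableOn.cpow_const (by fun_prop) hslit
    · simp [Complex.cpow_eq_zero_iff, Complex.slitPlane_ne_zero (hslit ξ hξ)]
  obtain ⟨c, hc, hc'⟩ := exists_hasSum_pow_of_differentiableOn hd
  refine ⟨c, fun ξ hξ => ?_, hc'⟩
  have := (hc ξ hξ).div_const (ξ ^ m)
  rwa [div_div, mul_comm ((1 - ξ) ^ _)] at this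

/-! ### From `ℓ¹` coefficients to the Bergman space. -/

theorem ae_mem_disk (α β : ℝ) : ∀ᵐ z ∂modMeasure α β, z ∈ disk :=
  (withDensity_absolutelyContinuous _ _).ae_le
    (ae_restrict_mem (show MeasurableSet disk from measurableSet_ball))

theorem lp_one_summable_norm (a : lp (fun _ : ℕ => ℂ) 1) : Summable fun n => ‖a n‖ := by
  simpa using (lp.hasSum_norm (p := 1) (by simp) a).summable

theorem lp_one_norm_eq_tsum (a : lp (fun _ : ℕ => ℂ) 1) : ‖a‖ = ∑' n, ‖a n‖ := by
  simpa using lp.norm_eq_tsum_rpow (p := 1) (by simp) a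

theorem norm_mul_pow_le_of_mem_disk {z : ℂ} (hz : z ∈ disk) (c : ℂ) (n : ℕ) :
    ‖c * z ^ n‖ ≤ ‖c‖ := by
  rw [norm_mul, norm_pow]
  refine mul_le_of_le_one_right (norm_nonneg _) (pow_le_one₀ (norm_nonneg _) ?_)
  simpa [disk] using (mem_ball_zero_iff.1 hz).le

theorem differentiableOn_tsum_lp_one (a : lp (fun _ : ℕ => ℂ) 1) :
    DifferentiableOn ℂ (fun z => ∑' n, a n * z ^ n) disk :=
  Complex.differentiableOn_tsum_of_summable_norm (lp_one_summable_norm a)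
    (fun n => by fun_prop) Metric.isOpen_ball fun n _ hw => norm_mul_pow_le_of_mem_disk hw _ n

theorem norm_tsum_lp_one_div_le (a : lp (fun _ : ℕ => ℂ) 1) (m : ℕ) {z : ℂ} (hz : z ∈ disk) :
    ‖(∑' n, a n * z ^ n) / z ^ m‖ ≤ ‖a‖ * ‖(‖z‖ ^ m)⁻¹‖ := by
  rw [norm_div, norm_pow, div_eq_mul_inv, lp_one_norm_eq_tsum, norm_inv, norm_pow, norm_norm]
  gcongr
  exact tsum_of_norm_bounded (lp_one_summable_norm a).hasSum
    fun n => norm_mul_pow_le_of_mem_disk hz _ n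

theorem differentiableOn_tsum_lp_one_div (a : lp (fun _ : ℕ => ℂ) 1) (m : ℕ) :
    DifferentiableOn ℂ (fun z => (∑' n, a n * z ^ n) / z ^ m) puncturedDisk :=
  ((differentiableOn_tsum_lp_one a).mono Set.sdiff_subset).div (by fun_prop)
    fun z hz => pow_ne_zero _ (by simpa using hz.2)

theorem aestronglyMeasurable_tsum_lp_one_div (a : lp (fun _ : ℕ => ℂ) 1) (m : ℕ) (α β : ℝ) :
    AEStronglyMeasurable (fun z => (∑' n, a n * z ^ n) / z ^ m) (modMeasure α β) := by
  have h := ((differentiableOn_tsum_lp_one a).continuousOn.aestronglyMeasurable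
    (show MeasurableSet disk from measurableSet_ball) (μ := volume)).mono_ac
    (withDensity_absolutelyContinuous (volume.restrict disk) fun z =>
    ENNReal.ofReal (‖z‖ ^ (2 * β) * (1 - ‖z‖ ^ 2) ^ α /
      (Real.pi * ProbabilityTheory.beta (α + 1) (β + 1))))
  simp only [div_eq_mul_inv]
  exact h.mul (Measurable.aestronglyMeasurable (by fun_prop))

/-- Absolutely summable sequences are the coefficients of functions in the modified Bergman space
with a pole of order at most `m` at the origin. -/
theorem exists_synthesis_operator {α β p : ℝ} {m : ℕ} [Fact (1 ≤ ENNReal.ofReal p)]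
    (hp : MemLp (fun z : ℂ => (‖z‖ ^ m)⁻¹) (ENNReal.ofReal p) (modMeasure α β)) :
    ∃ V : lp (fun _ : ℕ => ℂ) 1 →L[ℂ] bergmanSpace α β p, ∀ a,
      (V a : Lp ℂ (ENNReal.ofReal p) (modMeasure α β)) =ᵐ[modMeasure α β]
        fun z => (∑' n, a n * z ^ n) / z ^ m := by
  have hbd : ∀ a : lp (fun _ : ℕ => ℂ) 1, ∀ᵐ z ∂modMeasure α β,
      ‖(∑' n, a n * z ^ n) / z ^ m‖ ≤ ‖a‖ * ‖(‖z‖ ^ m)⁻¹‖ := fun a =>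
    (ae_mem_disk α β).mono fun z hz => norm_tsum_lp_one_div_le a m hz
  have hmem : ∀ a : lp (fun _ : ℕ => ℂ) 1,
      MemLp (fun z => (∑' n, a n * z ^ n) / z ^ m) (ENNReal.ofReal p) (modMeasure α β) := fun a =>
    hp.of_le_mul (aestronglyMeasurable_tsum_lp_one_div a m α β) (hbd a)
  have hsum : ∀ (a : lp (fun _ : ℕ => ℂ) 1) (z : ℂ), z ∈ disk →
      Summable fun n => a n * z ^ n := fun a z hz =>
    (lp_one_summable_norm a).of_norm_bounded fun n => norm_mul_pow_le_of_mem_disk hz _ n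
  let V₀ : lp (fun _ : ℕ => ℂ) 1 →ₗ[ℂ] bergmanSpace α β p :=
    { toFun := fun a => ⟨(hmem a).toLp, _, differentiableOn_tsum_lp_one_div a m,
        (hmem a).coeFn_toLp⟩
      map_add' := fun a b => by
        refine Subtype.ext ?_
        change (hmem (a + b)).toLp = (hmem a).toLp + (hmem b).toLp
        rw [← MemLp.toLp_add]
        refine MemLp.toLp_congr _ _ ((ae_mem_disk α β).mono fun z hz => ?_)
        simp only [Pi.add_apply, lp.coeFn_add, add_mul]
        rw [(hsum a z hz).tsum_add (hsum b z hz), add_div]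
      map_smul' := fun c a => by
        refine Subtype.ext ?_
        change (hmem (c • a)).toLp = c • (hmem a).toLp
        rw [← MemLp.toLp_const_smul]
        refine MemLp.toLp_congr _ _ ((ae_mem_disk α β).mono fun z hz => ?_)
        simp only [Pi.smul_apply, lp.coeFn_smul, smul_eq_mul, mul_assoc]
        rw [tsum_mul_left, mul_div_assoc] }
  refine ⟨V₀.mkContinuous ‖hp.toLp‖ fun a => ?_, fun a => (hmem a).coeFn_toLp⟩
  change ‖(hmem a).toLp‖ ≤ _
  rw [mul_comm]
  refine Lp.norm_le_mul_norm_of_ae_le_mul ?_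
  filter_upwards [hbd a, (hmem a).coeFn_toLp, hp.coeFn_toLp] with z h1 h2 h3
  rwa [h2, h3]

/-! ### Compact operators into `ℓ¹`. -/

/-- An absolutely summable sequence of functionals defines a compact operator into the space of
absolutely summable sequences. -/
theorem exists_isCompactOperator_of_summable_norm {E : Type*} [NormedAddCommGroup E]
    [NormedSpace ℂ E] (ℓ : ℕ → StrongDual ℂ E) (hℓ : Summable fun n => ‖ℓ n‖) :
    ∃ U : E →L[ℂ] lp (fun _ : ℕ => ℂ) 1, IsCompactOperator U ∧ ∀ f n, U f n = ℓ n f := by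
  let e : ℕ → lp (fun _ : ℕ => ℂ) 1 := fun n => lp.single 1 n (1 : ℂ)
  have hs : Summable fun n => (ℓ n).smulRight (e n) := by
    refine Summable.of_norm (hℓ.congr fun n => ?_)
    rw [ContinuousLinearMap.norm_smulRight_apply, lp.norm_single (by simp)]
    simp
  refine ⟨∑' n, (ℓ n).smulRight (e n), ?_, fun f n => ?_⟩
  -- Finite partial sums have finite rank, and operator-norm limits of compact operators are
  -- compact.
  · refine isCompactOperator_of_tendsto hs.hasSum (.of_forall fun s => ?_)
    refine Submodule.sum_mem (compactOperator (RingHom.id ℂ) E (lp (fun _ : ℕ => ℂ) 1))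
      fun n _ => ?_
    exact (isCompactOperator_of_locallyCompactSpace_rng
      (ContinuousLinearMap.toSpanSingleton ℂ (e n))).comp_clm (ℓ n)
  · have h := (hs.hasSum.mapL (ContinuousLinearMap.apply ℂ _ f)).mapL
      (lp.evalCLM ℂ (fun _ : ℕ => ℂ) 1 n)
    refine (h.unique (hasSum_single n fun k hk => ?_)).trans ?_
    · change ℓ k f * (e k) n = 0
      rw [show e k n = 0 from lp.single_apply_ne _ _ _ hk.symm, mul_zero]
    · change ℓ n f * (e n) n = _
      rw [show e n n = 1 from lp.single_apply_self _ _ _, mul_one]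

/-! ### Symbols supported in a smaller disk. -/

/-- A bounded symbol with compact support in the disk is bounded by a constant and supported in a
smaller disk. -/
theorem exists_bound_of_compact_support {φ : ℂ → ℂ} (α β : ℝ)
    (hφ : MemLp φ ∞ (volume.restrict disk))
    (hφ_supp : ∃ K : Set ℂ, IsCompact K ∧ K ⊆ disk ∧
      ∀ᵐ z ∂volume.restrict disk, z ∉ K → φ z = 0) :
    AEStronglyMeasurable φ (modMeasure α β) ∧ ∃ M r : ℝ, 0 ≤ r ∧ r < 1 ∧
      ∀ᵐ w ∂modMeasure α β, ∀ n : ℕ, ‖φ w‖ * ‖w‖ ^ n ≤ M * r ^ n := by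
  obtain ⟨K, hK, hKd, hsupp⟩ := hφ_supp
  have hac : modMeasure α β ≪ volume.restrict disk := withDensity_absolutelyContinuous _ _
  obtain ⟨r', hr', hKr⟩ := exists_lt_subset_ball hK.isClosed hKd
  -- The radius `r'` may be negative when `K` is empty, hence the maximum.
  refine ⟨hφ.1.mono_ac hac, (eLpNormEssSup φ (volume.restrict disk)).toReal, max r' 0,
    le_max_right _ _, max_lt hr' one_pos, ?_⟩
  have hfin : eLpNormEssSup φ (volume.restrict disk) < ∞ := by simpa using hφ.2
  filter_upwards [hac.ae_le hsupp, hac.ae_le (enorm_ae_le_eLpNormEssSup φ (volume.restrict disk))]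
    with w hw hb n
  by_cases hwK : w ∈ K
  · have h1 : ‖φ w‖ ≤ (eLpNormEssSup φ (volume.restrict disk)).toReal := by
      simpa using ENNReal.toReal_mono hfin.ne hb
    have h2 : ‖w‖ ≤ max r' 0 := le_max_of_le_left (mem_ball_zero_iff.1 (hKr hwK)).le
    gcongr
  · rw [hw hwK, norm_zero, zero_mul]
    have := le_max_right r' 0
    positivity

section Symbol

variable {α β p q M r : ℝ} {m : ℕ} {φ : ℂ → ℂ}

/-- The factor `r ^ n` is the gain from the support of `φ`; it is summable against the kernel
coefficients. -/
theorem ae_norm_mul_conj_pow_div_le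
    (hb : ∀ᵐ w ∂modMeasure α β, ∀ n : ℕ, ‖φ w‖ * ‖w‖ ^ n ≤ M * r ^ n) (n : ℕ) :
    ∀ᵐ w ∂modMeasure α β, ‖φ w * conj w ^ n / conj w ^ m‖ ≤ M * r ^ n * ‖(‖w‖ ^ m)⁻¹‖ := by
  filter_upwards [hb] with w hw
  rw [norm_div, norm_mul, norm_pow, norm_pow, RCLike.norm_conj, div_eq_mul_inv, norm_inv, norm_pow,
    norm_norm]
  exact mul_le_mul_of_nonneg_right (hw n) (by positivity)

theorem memLp_mul_conj_pow_div (hφ : AEStronglyMeasurable φ (modMeasure α β))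
    (hb : ∀ᵐ w ∂modMeasure α β, ∀ n : ℕ, ‖φ w‖ * ‖w‖ ^ n ≤ M * r ^ n)
    (hq : MemLp (fun z : ℂ => (‖z‖ ^ m)⁻¹) (ENNReal.ofReal q) (modMeasure α β)) (n : ℕ) :
    MemLp (fun w => φ w * conj w ^ n / conj w ^ m) (ENNReal.ofReal q) (modMeasure α β) := by
  refine hq.of_le_mul ?_ (ae_norm_mul_conj_pow_div_le hb n)
  simp only [mul_div_assoc]
  exact hφ.mul (Measurable.aestronglyMeasurable (by fun_prop))

theorem hasSum_integrand {α' β₀ : ℝ} {c : ℕ → ℂ}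
    (hc : ∀ ξ ∈ disk, HasSum (fun n => c n * ξ ^ n / ξ ^ m) (kernelFn α' β₀ m ξ))
    {z w : ℂ} (hz : z ∈ disk) (hw : w ∈ disk) (x : ℂ) :
    HasSum (fun n => c n * z ^ n / z ^ m * (φ w * conj w ^ n / conj w ^ m * x))
      (φ w * x * kernelFn α' β₀ m (z * conj w)) := by
  have hzw : z * conj w ∈ disk := by
    simp only [disk, mem_ball_zero_iff, norm_mul, RCLike.norm_conj] at *
    exact mul_lt_one_of_nonneg_of_lt_one_left (norm_nonneg _) hz hw.le
  refine ((hc _ hzw).mul_left (φ w * x)).congr_fun fun n => ?_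
  rw [mul_pow, mul_pow]
  simp only [div_eq_mul_inv, mul_inv]
  ring

/-- The kernel expansion may be integrated term by term against a symbol supported in a smaller
disk. -/
theorem integrable_and_hasSum_toeplitz [hpq : ENNReal.HolderConjugate (ENNReal.ofReal q)
      (ENNReal.ofReal p)] {β₀ : ℝ} (hβm : β = β₀ + m) {c : ℕ → ℂ}
    (hc : ∀ ξ ∈ disk, HasSum (fun n => c n * ξ ^ n / ξ ^ m) (kernelFn α β₀ m ξ))
    (hcs : Summable fun n => ‖c n‖ * r ^ n)
    (hφ : AEStronglyMeasurable φ (modMeasure α β))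
    (hb : ∀ᵐ w ∂modMeasure α β, ∀ n : ℕ, ‖φ w‖ * ‖w‖ ^ n ≤ M * r ^ n)
    (hq : MemLp (fun z : ℂ => (‖z‖ ^ m)⁻¹) (ENNReal.ofReal q) (modMeasure α β))
    {f : ℂ → ℂ} (hf : MemLp f (ENNReal.ofReal p) (modMeasure α β)) {z : ℂ} (hz : z ∈ disk) :
    Integrable (fun w => φ w * f w * kernelFn α β₀ m (z * conj w)) (modMeasure α β) ∧
    HasSum (fun n => c n * z ^ n / z ^ m *
      ∫ w, φ w * conj w ^ n / conj w ^ m * f w ∂modMeasure α β) (toeplitz α β₀ m φ f z) := by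
  set μ := modMeasure α β with hμ
  let F : ℕ → ℂ → ℂ := fun n w => c n * z ^ n / z ^ m * (φ w * conj w ^ n / conj w ^ m * f w)
  have hg : Integrable (fun w => ‖(‖w‖ ^ m)⁻¹‖ * ‖f w‖) μ := hq.norm.integrable_mul hf.norm
  have hFint : ∀ n, Integrable (F n) μ := fun n =>
    ((memLp_mul_conj_pow_div hφ hb hq n).integrable_mul hf).const_mul _
  let b : ℕ → ℝ := fun n => ‖c n‖ * r ^ n * (M * (‖z‖ ^ m)⁻¹)
  have hbs : Summable b := hcs.mul_right _
  have hFle : ∀ n, ∀ᵐ w ∂μ, ‖F n w‖ ≤ b n * (‖(‖w‖ ^ m)⁻¹‖ * ‖f w‖) := fun n => by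
    filter_upwards [ae_norm_mul_conj_pow_div_le (m := m) hb n] with w hw
    have h1 := norm_mul_pow_le_of_mem_disk hz (c n) n
    calc ‖F n w‖ = ‖c n * z ^ n‖ * (‖z‖ ^ m)⁻¹ * (‖φ w * conj w ^ n / conj w ^ m‖ * ‖f w‖) := by
          simp only [F]
          rw [norm_mul, norm_mul (_ / _) (f w), norm_div (c n * z ^ n), norm_pow z m, div_eq_mul_inv]
      _ ≤ ‖c n‖ * (‖z‖ ^ m)⁻¹ * (M * r ^ n * ‖(‖w‖ ^ m)⁻¹‖ * ‖f w‖) := by gcongr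
      _ = _ := by simp only [b]; ring
  have hsum : ∀ᵐ w ∂μ, HasSum (fun n => F n w) (φ w * f w * kernelFn α β₀ m (z * conj w)) :=
    (ae_mem_disk α β).mono fun w hw => hasSum_integrand hc hz hw (f w)
  have hFs : Summable fun n => ∫ w, ‖F n w‖ ∂μ := by
    refine Summable.of_nonneg_of_le (fun n => integral_nonneg fun w => norm_nonneg _) (fun n => ?_)
      (hbs.mul_right (∫ w, ‖(‖w‖ ^ m)⁻¹‖ * ‖f w‖ ∂μ))
    rw [← integral_const_mul]
    exact integral_mono_ae (hFint n).norm (hg.const_mul _) (hFle n)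
  constructor
  · refine Integrable.mono' (hg.const_mul (∑' n, b n)) ?_ ?_
    -- Measurability of the kernel integrand comes from its being the a.e. limit of the partial
    -- sums.
    · refine aestronglyMeasurable_of_tendsto_ae Filter.atTop
        (f := fun N w => ∑ n ∈ Finset.range N, F n w) (fun N => ?_)
        (hsum.mono fun w hw => hw.tendsto_sum_nat)
      exact (integrable_finsetSum _ fun n _ => hFint n).aestronglyMeasurable
    · filter_upwards [hsum, ae_all_iff.2 hFle] with w hw hle
      rw [← hw.tsum_eq]
      exact tsum_of_norm_bounded (hbs.hasSum.mul_right _) hle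
  · have h := hasSum_integral_of_summable_integral_norm hFint hFs
    simp only [F, integral_const_mul] at h
    convert! h using 1
    rw [toeplitz, bergmanProj, ← hβm, ← hμ]
    exact integral_congr_ae (hsum.mono fun w hw => hw.tsum_eq.symm)

/-- The Taylor coefficients of `z ^ m * T_φ f` depend compactly on `f`. -/
theorem exists_analysis_operator [hpq : ENNReal.HolderConjugate (ENNReal.ofReal q)
      (ENNReal.ofReal p)] [Fact (1 ≤ ENNReal.ofReal p)] [Fact (1 ≤ ENNReal.ofReal q)]
    {c : ℕ → ℂ} (hcs : Summable fun n => ‖c n‖ * r ^ n)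
    (hφ : AEStronglyMeasurable φ (modMeasure α β))
    (hb : ∀ᵐ w ∂modMeasure α β, ∀ n : ℕ, ‖φ w‖ * ‖w‖ ^ n ≤ M * r ^ n)
    (hq : MemLp (fun z : ℂ => (‖z‖ ^ m)⁻¹) (ENNReal.ofReal q) (modMeasure α β)) :
    ∃ U : Lp ℂ (ENNReal.ofReal p) (modMeasure α β) →L[ℂ] lp (fun _ : ℕ => ℂ) 1,
      IsCompactOperator U ∧ ∀ f n,
        U f n = c n * ∫ w, φ w * conj w ^ n / conj w ^ m * f w ∂modMeasure α β := by
  set μ := modMeasure α β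
  have hh := memLp_mul_conj_pow_div hφ hb hq
  let B := (ContinuousLinearMap.mul ℂ ℂ).lpPairing μ (ENNReal.ofReal q) (ENNReal.ofReal p)
  -- `B` is the bilinear `L^q`–`L^p` pairing, without conjugation.
  let ℓ : ℕ → StrongDual ℂ (Lp ℂ (ENNReal.ofReal p) μ) := fun n => c n • B (hh n).toLp
  have hn : ∀ n, ‖(hh n).toLp‖ ≤ M * r ^ n * ‖hq.toLp‖ := fun n => by
    refine Lp.norm_le_mul_norm_of_ae_le_mul ?_
    filter_upwards [ae_norm_mul_conj_pow_div_le (m := m) hb n, (hh n).coeFn_toLp, hq.coeFn_toLp]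
      with w h1 h2 h3
    rwa [h2, h3]
  obtain ⟨U, hU, hU'⟩ := exists_isCompactOperator_of_summable_norm ℓ <| by
    refine Summable.of_nonneg_of_le (fun n => norm_nonneg _) (fun n => ?_)
      (hcs.mul_right (‖B‖ * (M * ‖hq.toLp‖)))
    calc ‖ℓ n‖ ≤ ‖c n‖ * (‖B‖ * ‖(hh n).toLp‖) := by
          rw [norm_smul]
          gcongr
          exact B.le_opNorm _
      _ ≤ ‖c n‖ * (‖B‖ * (M * r ^ n * ‖hq.toLp‖)) := by
          gcongr
          exact hn n
      _ = _ := by ring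
  refine ⟨U, hU, fun f n => ?_⟩
  rw [hU']
  change c n * B (hh n).toLp f = _
  rw [ContinuousLinearMap.lpPairing_eq_integral]
  congr 1
  refine integral_congr_ae ((hh n).coeFn_toLp.mono fun w hw => ?_)
  simp [hw]

end Symbol

end ModifiedBergman

/-! ### Compactness of the Toeplitz operator. -/

theorem mainTheorem12 (α β β₀ : ℝ) (m : ℕ) (hα : -1 < α) (hβ : -1 < β)
    (hβm : β = β₀ + m) (hβ₀ : β₀ ∈ ModifiedBergman.J α)
    (p : ℝ) [Fact (1 ≤ ENNReal.ofReal p)]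
    (hp_lower : 2 * (β + 1) < p * (2 * (β + 1) - m))
    (hp_upper : p * m < 2 * (β + 1))
    (φ : ℂ → ℂ) (hφ : MemLp φ ∞ (volume.restrict ModifiedBergman.disk))
    (hφ_supp : ∃ K : Set ℂ, IsCompact K ∧ K ⊆ ModifiedBergman.disk ∧
      ∀ᵐ z ∂volume.restrict ModifiedBergman.disk, z ∉ K → φ z = 0) :
    -- the integral that defines `T_φ f` converges and is holomorphic on the punctured disk
    (∀ f : ModifiedBergman.bergmanSpace α β p,
      (∀ z ∈ ModifiedBergman.puncturedDisk,
        Integrable (fun w => φ w * (f : Lp ℂ (ENNReal.ofReal p) (ModifiedBergman.modMeasure α β)) w *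
          ModifiedBergman.kernelFn α β₀ m (z * conj w)) (ModifiedBergman.modMeasure α β)) ∧
      DifferentiableOn ℂ (ModifiedBergman.toeplitz α β₀ m φ
        (f : Lp ℂ (ENNReal.ofReal p) (ModifiedBergman.modMeasure α β)))
        ModifiedBergman.puncturedDisk) ∧
    -- `f ↦ T_φ f` is a compact operator of the Bergman space into itself
    ∃ T : ModifiedBergman.bergmanSpace α β p →L[ℂ] ModifiedBergman.bergmanSpace α β p,
      (∀ f : ModifiedBergman.bergmanSpace α β p,
        (T f : Lp ℂ (ENNReal.ofReal p) (ModifiedBergman.modMeasure α β))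
          =ᵐ[ModifiedBergman.modMeasure α β]
        ModifiedBergman.toeplitz α β₀ m φ
          (f : Lp ℂ (ENNReal.ofReal p) (ModifiedBergman.modMeasure α β))) ∧
      IsCompactOperator T := by
  have hp1 : 1 ≤ p := by simpa using (Fact.out : 1 ≤ ENNReal.ofReal p)
  have hm : (0 : ℝ) ≤ m := m.cast_nonneg
  have hp : 1 < p := by
    -- At `p = 1` the lower bound would read `m < 0`.
    refine lt_of_le_of_ne hp1 fun h => ?_
    rw [← h] at hp_lower
    linarith
  have hpq := Real.HolderConjugate.conjExponent hp
  set q := p.conjExponent with hq_def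
  -- With `q = p / (p - 1)` this is `hp_lower` rearranged.
  have hqm : q * m < 2 * (β + 1) := by
    rw [hq_def, Real.conjExponent, div_mul_eq_mul_div, div_lt_iff₀ (by linarith)]
    linarith
  have : ENNReal.HolderConjugate (ENNReal.ofReal q) (ENNReal.ofReal p) := hpq.symm.ennrealOfReal
  have : Fact (1 ≤ ENNReal.ofReal q) := ⟨by simpa using hpq.symm.lt.le⟩
  have hLp := ModifiedBergman.memLp_norm_pow_inv hα hpq.pos hp_upper
  have hLq := ModifiedBergman.memLp_norm_pow_inv hα hpq.symm.pos hqm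
  obtain ⟨hφm, M, r, hr, hr1, hb⟩ :=
    ModifiedBergman.exists_bound_of_compact_support α β hφ hφ_supp
  obtain ⟨c, hc, hcs⟩ := ModifiedBergman.exists_hasSum_kernelFn (α := α) (m := m) hβ₀.1
  obtain ⟨V, hV⟩ := ModifiedBergman.exists_synthesis_operator hLp
  obtain ⟨U, hU, hU'⟩ :=
    ModifiedBergman.exists_analysis_operator (p := p) (hcs r hr hr1) hφm hb hLq
  have key : ∀ f : Lp ℂ (ENNReal.ofReal p) (ModifiedBergman.modMeasure α β),
      ∀ z ∈ ModifiedBergman.disk,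
      Integrable (fun w => φ w * f w * ModifiedBergman.kernelFn α β₀ m (z * conj w))
        (ModifiedBergman.modMeasure α β) ∧
      ModifiedBergman.toeplitz α β₀ m φ f z = (∑' n, U f n * z ^ n) / z ^ m := fun f z hz => by
    obtain ⟨h1, h2⟩ := ModifiedBergman.integrable_and_hasSum_toeplitz hβm hc (hcs r hr hr1)
      hφm hb hLq (Lp.memLp f) hz
    refine ⟨h1, ?_⟩
    rw [← h2.tsum_eq, ← tsum_div_const]
    refine tsum_congr fun n => ?_
    rw [hU']
    ring
  refine ⟨fun f => ⟨fun z hz => (key f z hz.1).1, ?_⟩,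
    -- `U` acts on all of `L^p`, so it is restricted to the Bergman space.
    (V.comp U).comp (Submodule.subtypeL _), fun f => ?_, ?_⟩
  · exact (ModifiedBergman.differentiableOn_tsum_lp_one_div (U f) m).congr
      fun z hz => (key f z hz.1).2
  · filter_upwards [hV (U f), ModifiedBergman.ae_mem_disk α β] with z h1 h2
    rw [(key f z h2).2]
    exact h1
  · exact (hU.clm_comp V).comp_clm (Submodule.subtypeL _)
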